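/- **Theorem (Robust Relational Hyperproperty Preservation).** For every interface $I$ and every syntactically well-typed target context $C^T$ for $I$ there is a source context $C^S$ for $I$, namely the back-translation $C^S=C^T{\uparrow}$, such that for every partial source program $P$ with interface $I$ and every behaviour $t=(lt,r)$, consisting of a local trace $lt$ that is well formed from the empty history and a Boolean $r$, $$C^T[P{\downarrow}]\leadsto_T t\quad\Longleftrightarrow\quad C^S[P]\leadsto_S t .$$ The notions are as follows. *Events.* The operations are: open a file (a string), read from a file descriptor, write a string to a file descriptor, close a file descriptor (descriptors are natural numbers). Each operation returns either a result (respectively: a descriptor, a string, unit, unit) or an error (a string). An event records an operation with its arguments and its result. A history is the list of past events; $\mathrm{fresh}(h)$ is a descriptor larger than all those returned by openings in $h$. A local trace is well formed from $h$ if each successful opening in it returns the fresh descriptor of the history at that point. *Source.* Computations are elements of the free monad $\mathsf{io}$ on the four operations. A computation $m:\mathsf{io}\,A$ is interpreted as a monotone predicate transformer $\theta(m)$, which maps a history $h$ and a postcondition on local traces and results to a precondition; in it an opening may return $\mathrm{fresh}(h)$, a reading any string, a writing or closing unit, and every operation may fail with the fixed error $\mathtt{err}$. Write $m\Downarrow_h(lt,r)$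 if $p(lt,r)$ holds for every $p$ with $\theta(m)(h)(p)$; then $m\leadsto_S(lt,r)$ means $m\Downarrow_{[]}(lt,r)$. The quotable types are generated from unit, Booleans, strings and file descriptors by $A\to B$, $A\to\mathsf{io}\,B$, $A\times B$ and $A+B$. A typing relation, given by two mutually inductive families of derivations (for values and for $\mathsf{io}$-computations, both as functions of an evaluation environment), has rules for constants, variables, pure and effectful abstraction and application, conditionals, pairs, projections, injections, case analysis, monadic return and bind, and the four operations. An interface is a quotable type $c$. A source context is any element of $c$. A partial source program is a function $P:c\to\mathsf{io}\,\mathsf{bool}$ with a closed typing derivation for it. Linking $C^S[P]$ is the application $P(C^S)$. *Target.* The target is a call-by-value $\lambda$-calculus with unit, Booleans, strings, file descriptors, pairs, sums and the four operations, with a left-to-right small-step semantics in which a step from a history $h$ produces at most one event; operations have the same possible results as in the source. For a closed expression $e$, $e\leadsto_T(lt,r)$ means that $e$ reduces, from the empty history and producing exactly the events $lt$, to the (irreducible) Boolean constant $r$. Target expressions are typed with the quotable types, in a simple type system that distinguishes pure expressions (bodies of functions of type $A\to B$) from effectful ones (bodies of functions of type $A\to\mathsf{io}\,B$). A target context is a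 value with a closed typing derivation at type $c$. A target program is an untyped closed expression, and linking is syntactic application. *Translations.* $P{\downarrow}$ is defined by recursion on the typing derivation of $P$, mapping each rule to the corresponding target construct (and bind to a let-binding, i.e. an applied abstraction). $C^T{\uparrow}$ is defined by recursion on the typing derivation of $C^T$, mapping each rule to the corresponding source function, with effectful expressions interpreted in $\mathsf{io}$ and sequenced left to right. -/

import Mathlib

/-!
A shallowly embedded source language of terminating computations with file operations, carved out of
ordinary functions by a typing relation, a deeply embedded call-by-value target calculus with the
same operations, trace semantics for both, compilation, and back-translation of typed contexts.
-/

namespace SEIO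

/-! ### Operations, events and traces -/

/-- File descriptors are natural numbers. -/
abbrev FileDescr := ℕ

/-- Errors are strings. -/
abbrev Err := String

/-- The result of an operation that may fail. -/
abbrev ResExn (a : Type) := a ⊕ Err

/-- The three-letter string `err`, the only error that operations return. -/
def errMsg : Err := String.ofList [Char.ofNat 101, Char.ofNat 114, Char.ofNat 114]

/-- Events record the arguments and the result of an operation. -/
inductive Event : Type
  | read : FileDescr → ResExn String → Event
  | write : FileDescr → String → ResExn Unit → Event
  | openFile : String → ResExn FileDescr → Event
  | close : FileDescr → ResExn Unit → Event

abbrev Trace := List Event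

/-- Past events, the most recent one first. -/
abbrev History := List Event

/-- `h ++ lt`: the history after the local trace `lt` (in chronological order) has happened. -/
def History.app (h : History) (lt : Trace) : History := lt.reverse ++ h

/-- A file descriptor larger than all those that were generated in the history. -/
def freshFd : History → FileDescr
  | [] => 0
  | .openFile _ (.inl fd) :: h => max (fd + 1) (freshFd h)
  | _ :: h => freshFd h

/-- A successful opening must return the fresh descriptor of the current history. -/
def WfEvent (h : History) : Event → Prop
  | .openFile _ (.inl fd) => fd = freshFd h
  | _ => True

def WfLocalTrace : History → Trace → Prop
  | _, [] => True
  | h, ev :: lt => WfEvent h ev ∧ WfLocalTrace (ev :: h) lt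

/-- Local traces that are well formed with respect to the history from which they start. -/
abbrev LocalTrace (h : History) := {lt : Trace // WfLocalTrace h lt}

def LocalTrace.nil (h : History) : LocalTrace h := ⟨[], trivial⟩

theorem wfLocalTrace_append : ∀ (lt : Trace) (h : History) (lt' : Trace),
    WfLocalTrace h lt → WfLocalTrace (h.app lt) lt' → WfLocalTrace h (lt ++ lt')
  | [], _, _, _, h2 => by simpa [History.app] using h2
  | ev :: lt, h, lt', h1, h2 =>
    ⟨h1.1, wfLocalTrace_append lt (ev :: h) lt' h1.2 (by simpa [History.app] using h2)⟩

def LocalTrace.append {h : History} (lt : LocalTrace h) (lt' : LocalTrace (h.app lt.1)) :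
    LocalTrace h :=
  ⟨lt.1 ++ lt'.1, wfLocalTrace_append _ _ _ lt.2 lt'.2⟩

/-! ### The free monad of computations -/

inductive IoOp : Type
  | read | write | openFile | close

def IoArgs : IoOp → Type
  | .read => FileDescr
  | .write => FileDescr × String
  | .openFile => String
  | .close => FileDescr

def IoRes : IoOp → Type
  | .read => ResExn String
  | .write => ResExn Unit
  | .openFile => ResExn FileDescr
  | .close => ResExn Unit

inductive Io (a : Type) : Type
  | ret : a → Io a
  | call : (o : IoOp) → (args : IoArgs o) → (IoRes o → Io a) → Io a

def Io.bind {a b : Type} : Io a → (a → Io b) → Io b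
  | .ret x, k => k x
  | .call o args ok, k => .call o args (fun i => Io.bind (ok i) k)

def ioRead (fd : FileDescr) : Io (ResExn String) := .call .read fd .ret

def ioWrite (fd : FileDescr) (s : String) : Io (ResExn Unit) := .call .write (fd, s) .ret

def ioOpen (s : String) : Io (ResExn FileDescr) := .call .openFile s .ret

def ioClose (fd : FileDescr) : Io (ResExn Unit) := .call .close fd .ret

def opToEv : (o : IoOp) → IoArgs o → IoRes o → Event
  | .read, fd, r => .read fd r
  | .write, args, r => .write args.1 args.2 r
  | .openFile, s, r => .openFile s r
  | .close, fd, r => .close fd r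

/-- The possible results of an operation: an opening that succeeds returns the fresh descriptor, a
successful reading may return any string, and every operation may fail with the fixed error. -/
def IoPost (h : History) : (o : IoOp) → IoArgs o → IoRes o → Prop
  | .read, _, r => ∀ e : Err, r = Sum.inr e → e = errMsg
  | .write, _, r => ∀ e : Err, r = Sum.inr e → e = errMsg
  | .openFile, _, r =>
      (∀ fd : FileDescr, r = Sum.inl fd → fd = freshFd h) ∧ ∀ e : Err, r = Sum.inr e → e = errMsg
  | .close, _, r => ∀ e : Err, r = Sum.inr e → e = errMsg

/-! ### Predicate transformer semantics of computations -/

abbrev HistPost (h : History) (a : Type) := LocalTrace h → a → Prop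

abbrev Hist0 (a : Type) := (h : History) → HistPost h a → Prop

def HistPost.Le {h : History} {a : Type} (p1 p2 : HistPost h a) : Prop := ∀ lt r, p1 lt r → p2 lt r

def HistMonotonic {a : Type} (wp : Hist0 a) : Prop :=
  ∀ h (p1 p2 : HistPost h a), p1.Le p2 → wp h p1 → wp h p2

/-- Monotonic predicate transformers. -/
abbrev Hist (a : Type) := {wp : Hist0 a // HistMonotonic wp}

def histReturn {a : Type} (x : a) : Hist a :=
  ⟨fun h p => p (LocalTrace.nil h) x, fun _ _ _ hp hx => hp _ _ hx⟩

def postShift {a : Type} (h : History) (p : HistPost h a) (lt : LocalTrace h) :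
    HistPost (h.app lt.1) a :=
  fun lt' r => p (lt.append lt') r

def histPostBind {a b : Type} {h : History} (kw : a → Hist b) (p : HistPost h b) : HistPost h a :=
  fun lt r => (kw r).1 (h.app lt.1) (postShift h p lt)

def histBind {a b : Type} (w : Hist a) (kw : a → Hist b) : Hist b :=
  ⟨fun h p => w.1 h (histPostBind kw p), fun h _ _ hp hw =>
    w.2 h _ _ (fun _ r hk => (kw r).2 _ _ _ (fun _ _ hq => hp _ _ hq) hk) hw⟩

def opWp (o : IoOp) (args : IoArgs o) : Hist (IoRes o) :=
  ⟨fun h p => ∀ (lt : LocalTrace h) (r : IoRes o),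
      IoPost h o args r ∧ lt.1 = [opToEv o args r] → p lt r,
    fun _ _ _ hp hw _ _ hr => hp _ _ (hw _ _ hr)⟩

/-- The weakest precondition of a computation. -/
def theta {a : Type} : Io a → Hist a
  | .ret x => histReturn x
  | .call o args k => histBind (opWp o args) (fun r => theta (k r))

/-- Source behaviour: the strongest postcondition that corresponds to `theta m`. -/
def FsBeh {a : Type} (m : Io a) (h : History) : HistPost h a :=
  fun lt r => ∀ p : HistPost h a, (theta m).1 h p → p lt r

/-! ### Quotable types -/

/-- The types that can be quoted. -/
inductive TypeRep : Type → Type 1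
  | unit : TypeRep Unit
  | bool : TypeRep Bool
  | fileDescr : TypeRep FileDescr
  | string : TypeRep String
  | arr : {a b : Type} → TypeRep a → TypeRep b → TypeRep (a → b)
  | arrIo : {a b : Type} → TypeRep a → TypeRep b → TypeRep (a → Io b)
  | pair : {a b : Type} → TypeRep a → TypeRep b → TypeRep (a × b)
  | sum : {a b : Type} → TypeRep a → TypeRep b → TypeRep (a ⊕ b)

/-- A type together with a proof that it can be quoted. -/
abbrev QType := Σ a : Type, TypeRep a

abbrev qUnit : QType := ⟨Unit, .unit⟩
abbrev qBool : QType := ⟨Bool, .bool⟩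
abbrev qFileDescr : QType := ⟨FileDescr, .fileDescr⟩
abbrev qString : QType := ⟨String, .string⟩
abbrev qArr (a b : QType) : QType := ⟨a.1 → b.1, .arr a.2 b.2⟩
abbrev qArrIo (a b : QType) : QType := ⟨a.1 → Io b.1, .arrIo a.2 b.2⟩
abbrev qPair (a b : QType) : QType := ⟨a.1 × b.1, .pair a.2 b.2⟩
abbrev qSum (a b : QType) : QType := ⟨a.1 ⊕ b.1, .sum a.2 b.2⟩
abbrev qResExn (a : QType) : QType := qSum a qString

/-- Typing environments: the type of the de Bruijn variable `n` is the entry at position `n`. -/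
abbrev TypEnv := List QType

/-- Evaluation environments: stacks with one value for each entry of the typing environment. -/
def EvalEnv : TypEnv → Type
  | [] => Unit
  | a :: G => a.1 × EvalEnv G

def EvalEnv.push {G : TypEnv} {a : QType} (g : EvalEnv G) (x : a.1) : EvalEnv (a :: G) := (x, g)

def EvalEnv.hd {G : TypEnv} {a : QType} (g : EvalEnv (a :: G)) : a.1 := Prod.fst g

def EvalEnv.tail {G : TypEnv} {a : QType} (g : EvalEnv (a :: G)) : EvalEnv G := Prod.snd g

def EvalEnv.lookup : {G : TypEnv} → EvalEnv G → (n : ℕ) → {a : QType} → G[n]? = some a → a.1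
  | [], _, _, _, h => by simp at h
  | _ :: _, g, 0, _, h => (Option.some.inj h) ▸ g.hd
  | _ :: _, g, n + 1, _, h => EvalEnv.lookup g.tail n (by simpa using h)

/-! ### The source language: typing derivations of open values and of open computations -/

mutual

/-- Derivations for open values: functions from evaluation environments to values. -/
inductive TypingOVal : (G : TypEnv) → (a : QType) → (EvalEnv G → a.1) → Type 1
  | qtt : {G : TypEnv} → TypingOVal G qUnit (fun _ => ())
  | qtrue : {G : TypEnv} → TypingOVal G qBool (fun _ => true)
  | qfalse : {G : TypEnv} → TypingOVal G qBool (fun _ => false)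
  | qstringLit : {G : TypEnv} → (s : String) → TypingOVal G qString (fun _ => s)
  | qvar0 : {G : TypEnv} → {a : QType} → TypingOVal (a :: G) a (fun g => g.hd)
  | qvarS : {G : TypEnv} → {a b : QType} → {x : EvalEnv G → a.1} →
      TypingOVal G a x → TypingOVal (b :: G) a (fun g => x g.tail)
  | qapp : {G : TypEnv} → {a b : QType} → {f : EvalEnv G → a.1 → b.1} → {x : EvalEnv G → a.1} →
      TypingOVal G (qArr a b) f → TypingOVal G a x → TypingOVal G b (fun g => (f g) (x g))
  | qlambda : {G : TypEnv} → {a b : QType} → {body : EvalEnv (a :: G) → b.1} →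
      TypingOVal (a :: G) b body → TypingOVal G (qArr a b) (fun g x => body (g.push x))
  | qlambdaIo : {G : TypEnv} → {a b : QType} → {body : EvalEnv (a :: G) → Io b.1} →
      TypingOProd (a :: G) b body → TypingOVal G (qArrIo a b) (fun g x => body (g.push x))
  | qif : {G : TypEnv} → {a : QType} → {c : EvalEnv G → Bool} → {t e : EvalEnv G → a.1} →
      TypingOVal G qBool c → TypingOVal G a t → TypingOVal G a e →
      TypingOVal G a (fun g => cond (c g) (t g) (e g))
  | qmkpair : {G : TypEnv} → {a b : QType} → {x : EvalEnv G → a.1} → {y : EvalEnv G → b.1} →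
      TypingOVal G a x → TypingOVal G b y → TypingOVal G (qPair a b) (fun g => (x g, y g))
  | qfst : {G : TypEnv} → {a b : QType} → {x : EvalEnv G → a.1 × b.1} →
      TypingOVal G (qPair a b) x → TypingOVal G a (fun g => (x g).1)
  | qsnd : {G : TypEnv} → {a b : QType} → {x : EvalEnv G → a.1 × b.1} →
      TypingOVal G (qPair a b) x → TypingOVal G b (fun g => (x g).2)
  | qinl : {G : TypEnv} → {a b : QType} → {x : EvalEnv G → a.1} →
      TypingOVal G a x → TypingOVal G (qSum a b) (fun g => Sum.inl (x g))
  | qinr : {G : TypEnv} → {a b : QType} → {x : EvalEnv G → b.1} →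
      TypingOVal G b x → TypingOVal G (qSum a b) (fun g => Sum.inr (x g))
  | qcase : {G : TypEnv} → {a b c : QType} → {sc : EvalEnv G → a.1 ⊕ b.1} →
      {il : EvalEnv (a :: G) → c.1} → {ir : EvalEnv (b :: G) → c.1} →
      TypingOVal G (qSum a b) sc → TypingOVal (a :: G) c il → TypingOVal (b :: G) c ir →
      TypingOVal G c (fun g => Sum.elim (fun x => il (g.push x)) (fun y => ir (g.push y)) (sc g))

/-- Derivations for open computations. -/
inductive TypingOProd : (G : TypEnv) → (a : QType) → (EvalEnv G → Io a.1) → Type 1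
  | qreturn : {G : TypEnv} → {a : QType} → {x : EvalEnv G → a.1} →
      TypingOVal G a x → TypingOProd G a (fun g => Io.ret (x g))
  | qbind : {G : TypEnv} → {a b : QType} → {m : EvalEnv G → Io a.1} →
      {k : EvalEnv (a :: G) → Io b.1} →
      TypingOProd G a m → TypingOProd (a :: G) b k →
      TypingOProd G b (fun g => Io.bind (m g) (fun x => k (g.push x)))
  | qappIo : {G : TypEnv} → {a b : QType} → {f : EvalEnv G → a.1 → Io b.1} →
      {x : EvalEnv G → a.1} →
      TypingOVal G (qArrIo a b) f → TypingOVal G a x → TypingOProd G b (fun g => (f g) (x g))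
  | qifIo : {G : TypEnv} → {a : QType} → {c : EvalEnv G → Bool} → {t e : EvalEnv G → Io a.1} →
      TypingOVal G qBool c → TypingOProd G a t → TypingOProd G a e →
      TypingOProd G a (fun g => cond (c g) (t g) (e g))
  | qcaseIo : {G : TypEnv} → {a b c : QType} → {sc : EvalEnv G → a.1 ⊕ b.1} →
      {il : EvalEnv (a :: G) → Io c.1} → {ir : EvalEnv (b :: G) → Io c.1} →
      TypingOVal G (qSum a b) sc → TypingOProd (a :: G) c il → TypingOProd (b :: G) c ir →
      TypingOProd G c (fun g => Sum.elim (fun x => il (g.push x)) (fun y => ir (g.push y)) (sc g))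
  | qread : {G : TypEnv} → {fd : EvalEnv G → FileDescr} →
      TypingOVal G qFileDescr fd → TypingOProd G (qResExn qString) (fun g => ioRead (fd g))
  | qwrite : {G : TypEnv} → {fd : EvalEnv G → FileDescr} → {s : EvalEnv G → String} →
      TypingOVal G qFileDescr fd → TypingOVal G qString s →
      TypingOProd G (qResExn qUnit) (fun g => ioWrite (fd g) (s g))
  | qopenfile : {G : TypEnv} → {s : EvalEnv G → String} →
      TypingOVal G qString s → TypingOProd G (qResExn qFileDescr) (fun g => ioOpen (s g))
  | qclose : {G : TypEnv} → {fd : EvalEnv G → FileDescr} →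
      TypingOVal G qFileDescr fd → TypingOProd G (qResExn qUnit) (fun g => ioClose (fd g))

end

/-! ### The target calculus -/

/-- Expressions, with de Bruijn indices; `lam` and both branches of `case` bind one variable. -/
inductive Exp : Type
  | var : ℕ → Exp
  | unit : Exp
  | tru : Exp
  | fls : Exp
  | fileDescr : FileDescr → Exp
  | string : String → Exp
  | lam : Exp → Exp
  | app : Exp → Exp → Exp
  | ite : Exp → Exp → Exp → Exp
  | pair : Exp → Exp → Exp
  | fst : Exp → Exp
  | snd : Exp → Exp
  | inl : Exp → Exp
  | inr : Exp → Exp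
  | case : Exp → Exp → Exp → Exp
  | read : Exp → Exp
  | write : Exp → Exp → Exp
  | openFile : Exp → Exp
  | close : Exp → Exp

/-- All free variables are smaller than `n`. -/
def Exp.ClosedAt : ℕ → Exp → Prop
  | n, .var x => x < n
  | _, .unit => True
  | _, .tru => True
  | _, .fls => True
  | _, .fileDescr _ => True
  | _, .string _ => True
  | n, .lam e => e.ClosedAt (n + 1)
  | n, .app e1 e2 => e1.ClosedAt n ∧ e2.ClosedAt n
  | n, .ite e1 e2 e3 => e1.ClosedAt n ∧ e2.ClosedAt n ∧ e3.ClosedAt n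
  | n, .pair e1 e2 => e1.ClosedAt n ∧ e2.ClosedAt n
  | n, .fst e => e.ClosedAt n
  | n, .snd e => e.ClosedAt n
  | n, .inl e => e.ClosedAt n
  | n, .inr e => e.ClosedAt n
  | n, .case e1 e2 e3 => e1.ClosedAt n ∧ e2.ClosedAt (n + 1) ∧ e3.ClosedAt (n + 1)
  | n, .read e => e.ClosedAt n
  | n, .write e1 e2 => e1.ClosedAt n ∧ e2.ClosedAt n
  | n, .openFile e => e.ClosedAt n
  | n, .close e => e.ClosedAt n

abbrev ClosedExp := {e : Exp // e.ClosedAt 0}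

/-- Values: closed expressions in introduction form. -/
def Exp.IsValue : Exp → Prop
  | .unit => True
  | .tru => True
  | .fls => True
  | .fileDescr _ => True
  | .string _ => True
  | .lam e => e.ClosedAt 1
  | .pair e1 e2 => e1.IsValue ∧ e2.IsValue
  | .inl e => e.IsValue
  | .inr e => e.IsValue
  | _ => False

abbrev Value := {e : Exp // e.IsValue}

theorem Exp.IsValue.closed : ∀ {e : Exp}, e.IsValue → e.ClosedAt 0
  | .unit, _ => trivial
  | .tru, _ => trivial
  | .fls, _ => trivial
  | .fileDescr _, _ => trivial
  | .string _, _ => trivial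
  | .lam _, h => h
  | .pair _ _, h => ⟨Exp.IsValue.closed h.1, Exp.IsValue.closed h.2⟩
  | .inl e, h => Exp.IsValue.closed (e := e) h
  | .inr e, h => Exp.IsValue.closed (e := e) h

/-- Lift a renaming below one binder. -/
def liftRen (r : ℕ → ℕ) : ℕ → ℕ
  | 0 => 0
  | n + 1 => r n + 1

def Exp.rename : (ℕ → ℕ) → Exp → Exp
  | r, .var x => .var (r x)
  | _, .unit => .unit
  | _, .tru => .tru
  | _, .fls => .fls
  | _, .fileDescr fd => .fileDescr fd
  | _, .string s => .string s
  | r, .lam e => .lam (e.rename (liftRen r))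
  | r, .app e1 e2 => .app (e1.rename r) (e2.rename r)
  | r, .ite e1 e2 e3 => .ite (e1.rename r) (e2.rename r) (e3.rename r)
  | r, .pair e1 e2 => .pair (e1.rename r) (e2.rename r)
  | r, .fst e => .fst (e.rename r)
  | r, .snd e => .snd (e.rename r)
  | r, .inl e => .inl (e.rename r)
  | r, .inr e => .inr (e.rename r)
  | r, .case e1 e2 e3 => .case (e1.rename r) (e2.rename (liftRen r)) (e3.rename (liftRen r))
  | r, .read e => .read (e.rename r)
  | r, .write e1 e2 => .write (e1.rename r) (e2.rename r)
  | r, .openFile e => .openFile (e.rename r)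
  | r, .close e => .close (e.rename r)

/-- Lift a parallel substitution below one binder. -/
def liftSub (s : ℕ → Exp) : ℕ → Exp
  | 0 => .var 0
  | n + 1 => (s n).rename Nat.succ

def Exp.subst : (ℕ → Exp) → Exp → Exp
  | s, .var x => s x
  | _, .unit => .unit
  | _, .tru => .tru
  | _, .fls => .fls
  | _, .fileDescr fd => .fileDescr fd
  | _, .string s => .string s
  | s, .lam e => .lam (e.subst (liftSub s))
  | s, .app e1 e2 => .app (e1.subst s) (e2.subst s)
  | s, .ite e1 e2 e3 => .ite (e1.subst s) (e2.subst s) (e3.subst s)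
  | s, .pair e1 e2 => .pair (e1.subst s) (e2.subst s)
  | s, .fst e => .fst (e.subst s)
  | s, .snd e => .snd (e.subst s)
  | s, .inl e => .inl (e.subst s)
  | s, .inr e => .inr (e.subst s)
  | s, .case e1 e2 e3 => .case (e1.subst s) (e2.subst (liftSub s)) (e3.subst (liftSub s))
  | s, .read e => .read (e.subst s)
  | s, .write e1 e2 => .write (e1.subst s) (e2.subst s)
  | s, .openFile e => .openFile (e.subst s)
  | s, .close e => .close (e.subst s)

/-- Replace the variable `0` by `v` and decrement the other variables. -/
def substBeta (v e : Exp) : Exp :=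
  e.subst (fun n => Nat.casesOn n v Exp.var)

/-- One step of left-to-right call-by-value reduction from a history, with the event it produces,
if any. Closed expressions only step to closed expressions, and every event that a step produces is
well formed with respect to the history. -/
inductive Step : Exp → Exp → History → Option Event → Prop
  | appLeft {e1 e1' e2 : Exp} {h : History} {oev : Option Event} :
      Step e1 e1' h oev → Step (.app e1 e2) (.app e1' e2) h oev
  | appRight {v e2 e2' : Exp} {h : History} {oev : Option Event} : v.IsValue →
      Step e2 e2' h oev → Step (.app v e2) (.app v e2') h oev
  | beta {e v : Exp} {h : History} : v.IsValue → Step (.app (.lam e) v) (substBeta v e) h none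
  | ite {c c' e1 e2 : Exp} {h : History} {oev : Option Event} :
      Step c c' h oev → Step (.ite c e1 e2) (.ite c' e1 e2) h oev
  | iteTrue {e1 e2 : Exp} {h : History} : Step (.ite .tru e1 e2) e1 h none
  | iteFalse {e1 e2 : Exp} {h : History} : Step (.ite .fls e1 e2) e2 h none
  | pairLeft {e1 e1' e2 : Exp} {h : History} {oev : Option Event} :
      Step e1 e1' h oev → Step (.pair e1 e2) (.pair e1' e2) h oev
  | pairRight {v e2 e2' : Exp} {h : History} {oev : Option Event} : v.IsValue →
      Step e2 e2' h oev → Step (.pair v e2) (.pair v e2') h oev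
  | fst {e e' : Exp} {h : History} {oev : Option Event} :
      Step e e' h oev → Step (.fst e) (.fst e') h oev
  | fstPair {v1 v2 : Exp} {h : History} : v1.IsValue → v2.IsValue →
      Step (.fst (.pair v1 v2)) v1 h none
  | snd {e e' : Exp} {h : History} {oev : Option Event} :
      Step e e' h oev → Step (.snd e) (.snd e') h oev
  | sndPair {v1 v2 : Exp} {h : History} : v1.IsValue → v2.IsValue →
      Step (.snd (.pair v1 v2)) v2 h none
  | inl {e e' : Exp} {h : History} {oev : Option Event} :
      Step e e' h oev → Step (.inl e) (.inl e') h oev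
  | inr {e e' : Exp} {h : History} {oev : Option Event} :
      Step e e' h oev → Step (.inr e) (.inr e') h oev
  | case {e e' e1 e2 : Exp} {h : History} {oev : Option Event} :
      Step e e' h oev → Step (.case e e1 e2) (.case e' e1 e2) h oev
  | caseInl {v e1 e2 : Exp} {h : History} : v.IsValue →
      Step (.case (.inl v) e1 e2) (substBeta v e1) h none
  | caseInr {v e1 e2 : Exp} {h : History} : v.IsValue →
      Step (.case (.inr v) e1 e2) (substBeta v e2) h none
  | read {e e' : Exp} {h : History} {oev : Option Event} :
      Step e e' h oev → Step (.read e) (.read e') h oev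
  | readSuccess (fd : FileDescr) (s : String) (h : History) :
      Step (.read (.fileDescr fd)) (.inl (.string s)) h (some (.read fd (.inl s)))
  | readFail (fd : FileDescr) (h : History) :
      Step (.read (.fileDescr fd)) (.inr (.string errMsg)) h (some (.read fd (.inr errMsg)))
  | writeLeft {e1 e1' e2 : Exp} {h : History} {oev : Option Event} :
      Step e1 e1' h oev → Step (.write e1 e2) (.write e1' e2) h oev
  | writeRight {v e2 e2' : Exp} {h : History} {oev : Option Event} : v.IsValue →
      Step e2 e2' h oev → Step (.write v e2) (.write v e2') h oev
  | writeSuccess (fd : FileDescr) (s : String) (h : History) :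
      Step (.write (.fileDescr fd) (.string s)) (.inl .unit) h (some (.write fd s (.inl ())))
  | writeFail (fd : FileDescr) (s : String) (h : History) :
      Step (.write (.fileDescr fd) (.string s)) (.inr (.string errMsg)) h
        (some (.write fd s (.inr errMsg)))
  | openFile {e e' : Exp} {h : History} {oev : Option Event} :
      Step e e' h oev → Step (.openFile e) (.openFile e') h oev
  | openSuccess (s : String) (h : History) :
      Step (.openFile (.string s)) (.inl (.fileDescr (freshFd h))) h
        (some (.openFile s (.inl (freshFd h))))
  | openFail (s : String) (h : History) :
      Step (.openFile (.string s)) (.inr (.string errMsg)) h (some (.openFile s (.inr errMsg)))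
  | close {e e' : Exp} {h : History} {oev : Option Event} :
      Step e e' h oev → Step (.close e) (.close e') h oev
  | closeSuccess (fd : FileDescr) (h : History) :
      Step (.close (.fileDescr fd)) (.inl .unit) h (some (.close fd (.inl ())))
  | closeFail (fd : FileDescr) (h : History) :
      Step (.close (.fileDescr fd)) (.inr (.string errMsg)) h (some (.close fd (.inr errMsg)))

/-- The reflexive-transitive closure of `Step`, with the local trace of the events produced. -/
inductive Steps : Exp → Exp → History → Trace → Prop
  | refl (e : Exp) (h : History) : Steps e e h []
  | trans {e1 e2 e3 : Exp} {h : History} {oev : Option Event} {lt : Trace} :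
      Step e1 e2 h oev → Steps e2 e3 (h.app oev.toList) lt → Steps e1 e3 h (oev.toList ++ lt)

def Irreducible (e : Exp) (h : History) : Prop := ∀ e' oev, ¬ Step e e' h oev

/-- Target behaviour: `e` reduces to the irreducible expression `e'` with local trace `lt`. -/
def EBeh (e e' : Exp) (h : History) (lt : LocalTrace h) : Prop :=
  Steps e e' h lt.1 ∧ Irreducible e' (h.app lt.1)

/-- Effects: an expression typed at `pure` performs no operation. -/
inductive Eff : Type
  | pure | io

/-- Syntactic typing derivations of the target calculus. Since types distinguish pure functions from
effectful ones, the judgement carries an effect: `Typing .pure G e a` types pure expressions, and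
`Typing .io G e a` arbitrary ones. The body of a function of pure type is pure. -/
inductive Typing : Eff → TypEnv → Exp → QType → Type 1
  | var {ε : Eff} {G : TypEnv} {a : QType} (n : ℕ) : G[n]? = some a → Typing ε G (.var n) a
  | unit {ε : Eff} {G : TypEnv} : Typing ε G .unit qUnit
  | tru {ε : Eff} {G : TypEnv} : Typing ε G .tru qBool
  | fls {ε : Eff} {G : TypEnv} : Typing ε G .fls qBool
  | fileDescr {ε : Eff} {G : TypEnv} (fd : FileDescr) : Typing ε G (.fileDescr fd) qFileDescr
  | string {ε : Eff} {G : TypEnv} (s : String) : Typing ε G (.string s) qString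
  | lam {ε : Eff} {G : TypEnv} {a b : QType} {e : Exp} :
      Typing .pure (a :: G) e b → Typing ε G (.lam e) (qArr a b)
  | lamIo {ε : Eff} {G : TypEnv} {a b : QType} {e : Exp} :
      Typing .io (a :: G) e b → Typing ε G (.lam e) (qArrIo a b)
  | app {ε : Eff} {G : TypEnv} {a b : QType} {e1 e2 : Exp} :
      Typing ε G e1 (qArr a b) → Typing ε G e2 a → Typing ε G (.app e1 e2) b
  | appIo {G : TypEnv} {a b : QType} {e1 e2 : Exp} :
      Typing .io G e1 (qArrIo a b) → Typing .io G e2 a → Typing .io G (.app e1 e2) b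
  | ite {ε : Eff} {G : TypEnv} {a : QType} {e1 e2 e3 : Exp} :
      Typing ε G e1 qBool → Typing ε G e2 a → Typing ε G e3 a → Typing ε G (.ite e1 e2 e3) a
  | pair {ε : Eff} {G : TypEnv} {a b : QType} {e1 e2 : Exp} :
      Typing ε G e1 a → Typing ε G e2 b → Typing ε G (.pair e1 e2) (qPair a b)
  | fst {ε : Eff} {G : TypEnv} {a b : QType} {e : Exp} :
      Typing ε G e (qPair a b) → Typing ε G (.fst e) a
  | snd {ε : Eff} {G : TypEnv} {a b : QType} {e : Exp} :
      Typing ε G e (qPair a b) → Typing ε G (.snd e) b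
  | inl {ε : Eff} {G : TypEnv} {a b : QType} {e : Exp} :
      Typing ε G e a → Typing ε G (.inl e) (qSum a b)
  | inr {ε : Eff} {G : TypEnv} {a b : QType} {e : Exp} :
      Typing ε G e b → Typing ε G (.inr e) (qSum a b)
  | case {ε : Eff} {G : TypEnv} {a b c : QType} {e1 e2 e3 : Exp} :
      Typing ε G e1 (qSum a b) → Typing ε (a :: G) e2 c → Typing ε (b :: G) e3 c →
      Typing ε G (.case e1 e2 e3) c
  | read {G : TypEnv} {e : Exp} :
      Typing .io G e qFileDescr → Typing .io G (.read e) (qResExn qString)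
  | write {G : TypEnv} {e1 e2 : Exp} :
      Typing .io G e1 qFileDescr → Typing .io G e2 qString →
      Typing .io G (.write e1 e2) (qResExn qUnit)
  | openFile {G : TypEnv} {e : Exp} :
      Typing .io G e qString → Typing .io G (.openFile e) (qResExn qFileDescr)
  | close {G : TypEnv} {e : Exp} :
      Typing .io G e qFileDescr → Typing .io G (.close e) (qResExn qUnit)

/-! ### Compilation: generation of target syntax from source derivations -/

mutual

def compileVal : {G : TypEnv} → {a : QType} → {x : EvalEnv G → a.1} → TypingOVal G a x → Exp
  | _, _, _, .qtt => .unit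
  | _, _, _, .qtrue => .tru
  | _, _, _, .qfalse => .fls
  | _, _, _, .qstringLit s => .string s
  | _, _, _, .qvar0 => .var 0
  | _, _, _, .qvarS d => (compileVal d).rename Nat.succ
  | _, _, _, .qapp d1 d2 => .app (compileVal d1) (compileVal d2)
  | _, _, _, .qlambda d => .lam (compileVal d)
  | _, _, _, .qlambdaIo d => .lam (compileProd d)
  | _, _, _, .qif d1 d2 d3 => .ite (compileVal d1) (compileVal d2) (compileVal d3)
  | _, _, _, .qmkpair d1 d2 => .pair (compileVal d1) (compileVal d2)
  | _, _, _, .qfst d => .fst (compileVal d)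
  | _, _, _, .qsnd d => .snd (compileVal d)
  | _, _, _, .qinl d => .inl (compileVal d)
  | _, _, _, .qinr d => .inr (compileVal d)
  | _, _, _, .qcase d1 d2 d3 => .case (compileVal d1) (compileVal d2) (compileVal d3)

def compileProd : {G : TypEnv} → {a : QType} → {m : EvalEnv G → Io a.1} → TypingOProd G a m → Exp
  | _, _, _, .qreturn d => compileVal d
  | _, _, _, .qbind d1 d2 => .app (.lam (compileProd d2)) (compileProd d1)
  | _, _, _, .qappIo d1 d2 => .app (compileVal d1) (compileVal d2)
  | _, _, _, .qifIo d1 d2 d3 => .ite (compileVal d1) (compileProd d2) (compileProd d3)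
  | _, _, _, .qcaseIo d1 d2 d3 => .case (compileVal d1) (compileProd d2) (compileProd d3)
  | _, _, _, .qread d => .read (compileVal d)
  | _, _, _, .qwrite d1 d2 => .write (compileVal d1) (compileVal d2)
  | _, _, _, .qopenfile d => .openFile (compileVal d)
  | _, _, _, .qclose d => .close (compileVal d)

end

theorem Exp.ClosedAt.rename : ∀ (e : Exp) {n m : ℕ} {r : ℕ → ℕ}, (∀ x, x < n → r x < m) →
    e.ClosedAt n → (e.rename r).ClosedAt m := by
  have lift : ∀ {n m : ℕ} {r : ℕ → ℕ}, (∀ x, x < n → r x < m) →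
      ∀ x, x < n + 1 → liftRen r x < m + 1 := by
    intro n m r hr x hx
    cases x with
    | zero => simp [liftRen]
    | succ x => simpa [liftRen] using hr x (by omega)
  intro e
  induction e with
  | var x => intro n m r hr h; exact hr x h
  | unit | tru | fls | fileDescr | string => intros; trivial
  | lam e ih => intro n m r hr h; exact ih (lift hr) h
  | app _ _ ih1 ih2 | pair _ _ ih1 ih2 | write _ _ ih1 ih2 =>
    intro n m r hr h; exact ⟨ih1 hr h.1, ih2 hr h.2⟩
  | ite _ _ _ ih1 ih2 ih3 => intro n m r hr h; exact ⟨ih1 hr h.1, ih2 hr h.2.1, ih3 hr h.2.2⟩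
  | case _ _ _ ih1 ih2 ih3 =>
    intro n m r hr h; exact ⟨ih1 hr h.1, ih2 (lift hr) h.2.1, ih3 (lift hr) h.2.2⟩
  | fst _ ih | snd _ ih | inl _ ih | inr _ ih | read _ ih | openFile _ ih | close _ ih =>
    intro n m r hr h; exact ih hr h

mutual

theorem compileVal_closed : {G : TypEnv} → {a : QType} → {x : EvalEnv G → a.1} →
    (d : TypingOVal G a x) → (compileVal d).ClosedAt G.length
  | _, _, _, .qtt => trivial
  | _, _, _, .qtrue => trivial
  | _, _, _, .qfalse => trivial
  | _, _, _, .qstringLit _ => trivial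
  | _, _, _, .qvar0 => Nat.succ_pos _
  | _, _, _, .qvarS d => (compileVal_closed d).rename _ (fun _ hx => Nat.succ_lt_succ hx)
  | _, _, _, .qapp d1 d2 => ⟨compileVal_closed d1, compileVal_closed d2⟩
  | _, _, _, .qlambda d => compileVal_closed d
  | _, _, _, .qlambdaIo d => compileProd_closed d
  | _, _, _, .qif d1 d2 d3 => ⟨compileVal_closed d1, compileVal_closed d2, compileVal_closed d3⟩
  | _, _, _, .qmkpair d1 d2 => ⟨compileVal_closed d1, compileVal_closed d2⟩
  | _, _, _, .qfst d => compileVal_closed d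
  | _, _, _, .qsnd d => compileVal_closed d
  | _, _, _, .qinl d => compileVal_closed d
  | _, _, _, .qinr d => compileVal_closed d
  | _, _, _, .qcase d1 d2 d3 => ⟨compileVal_closed d1, compileVal_closed d2, compileVal_closed d3⟩

theorem compileProd_closed : {G : TypEnv} → {a : QType} → {m : EvalEnv G → Io a.1} →
    (d : TypingOProd G a m) → (compileProd d).ClosedAt G.length
  | _, _, _, .qreturn d => compileVal_closed d
  | _, _, _, .qbind d1 d2 => ⟨compileProd_closed d2, compileProd_closed d1⟩
  | _, _, _, .qappIo d1 d2 => ⟨compileVal_closed d1, compileVal_closed d2⟩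
  | _, _, _, .qifIo d1 d2 d3 =>
    ⟨compileVal_closed d1, compileProd_closed d2, compileProd_closed d3⟩
  | _, _, _, .qcaseIo d1 d2 d3 =>
    ⟨compileVal_closed d1, compileProd_closed d2, compileProd_closed d3⟩
  | _, _, _, .qread d => compileVal_closed d
  | _, _, _, .qwrite d1 d2 => ⟨compileVal_closed d1, compileVal_closed d2⟩
  | _, _, _, .qopenfile d => compileVal_closed d
  | _, _, _, .qclose d => compileVal_closed d

end

/-! ### Back-translation: from target typing derivations to source values and computations -/

/-- The source type of expressions of type `a` and effect `ε`. -/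
def Eff.M : Eff → Type → Type
  | .pure, a => a
  | .io, a => Io a

def Eff.ret : (ε : Eff) → {a : Type} → a → ε.M a
  | .pure, _, x => x
  | .io, _, x => Io.ret x

def Eff.bind : (ε : Eff) → {a b : Type} → ε.M a → (a → ε.M b) → ε.M b
  | .pure, _, _, x, k => k x
  | .io, _, _, m, k => Io.bind m k

def backExp : {ε : Eff} → {G : TypEnv} → {e : Exp} → {a : QType} →
    Typing ε G e a → EvalEnv G → ε.M a.1
  | ε, _, _, _, .var n hn, g => ε.ret (g.lookup n hn)
  | ε, _, _, _, .unit, _ => ε.ret ()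
  | ε, _, _, _, .tru, _ => ε.ret true
  | ε, _, _, _, .fls, _ => ε.ret false
  | ε, _, _, _, .fileDescr fd, _ => ε.ret fd
  | ε, _, _, _, .string s, _ => ε.ret s
  | ε, _, _, _, .lam d, g => ε.ret (fun x => backExp d (g.push x))
  | ε, _, _, _, .lamIo d, g => ε.ret (fun x => backExp d (g.push x))
  | ε, _, _, _, .app d1 d2, g =>
      ε.bind (backExp d1 g) (fun f => ε.bind (backExp d2 g) (fun x => ε.ret (f x)))
  | _, _, _, _, .appIo d1 d2, g =>
      Io.bind (backExp d1 g) (fun f => Io.bind (backExp d2 g) (fun x => f x))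
  | ε, _, _, _, .ite d1 d2 d3, g =>
      ε.bind (backExp d1 g) (fun c => cond c (backExp d2 g) (backExp d3 g))
  | ε, _, _, _, .pair d1 d2, g =>
      ε.bind (backExp d1 g) (fun x => ε.bind (backExp d2 g) (fun y => ε.ret (x, y)))
  | ε, _, _, _, .fst d, g => ε.bind (backExp d g) (fun x => ε.ret x.1)
  | ε, _, _, _, .snd d, g => ε.bind (backExp d g) (fun x => ε.ret x.2)
  | ε, _, _, _, .inl d, g => ε.bind (backExp d g) (fun x => ε.ret (Sum.inl x))
  | ε, _, _, _, .inr d, g => ε.bind (backExp d g) (fun x => ε.ret (Sum.inr x))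
  | ε, _, _, _, .case d1 d2 d3, g =>
      ε.bind (backExp d1 g) (fun s =>
        Sum.elim (fun x => backExp d2 (g.push x)) (fun y => backExp d3 (g.push y)) s)
  | _, _, _, _, .read d, g => Io.bind (backExp d g) (fun fd => ioRead fd)
  | _, _, _, _, .write d1 d2, g =>
      Io.bind (backExp d1 g) (fun fd => Io.bind (backExp d2 g) (fun s => ioWrite fd s))
  | _, _, _, _, .openFile d, g => Io.bind (backExp d g) (fun s => ioOpen s)
  | _, _, _, _, .close d, g => Io.bind (backExp d g) (fun fd => ioClose fd)

/-! ### Partial programs, contexts, linking and whole programs -/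

/-- The interface shared by programs and contexts: the (quotable) type of the context. -/
structure Interface : Type 1 where
  ct : Type
  qtyp : TypeRep ct

abbrev Interface.qct (I : Interface) : QType := ⟨I.ct, I.qtyp⟩

/-- A partial source program: a function on contexts, with a derivation for it. -/
def ProgS (I : Interface) : Type 1 :=
  Σ ps : I.ct → Io Bool, TypingOVal [] (qArrIo I.qct qBool) (fun _ => ps)

/-- A source context is any inhabitant of the type in the interface. -/
def CtxS (I : Interface) : Type := I.ct

abbrev WholeS := Io Bool

def linkS {I : Interface} (P : ProgS I) (C : CtxS I) : WholeS := P.1 C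

/-- Target programs are untyped closed expressions. -/
def ProgT (_ : Interface) : Type := ClosedExp

/-- A target context: a value with a syntactic typing derivation at the type in the interface. -/
def CtxT (I : Interface) : Type 1 := Σ v : Value, Typing .pure [] v.1 I.qct

abbrev WholeT := ClosedExp

def linkT {I : Interface} (P : ProgT I) (C : CtxT I) : WholeT :=
  ⟨.app P.1 C.1.1, P.2, C.1.2.closed⟩

def compile {I : Interface} (P : ProgS I) : ProgT I := ⟨compileVal P.2, compileVal_closed P.2⟩

def backTranslate {I : Interface} (C : CtxT I) : CtxS I := backExp C.2 ()

/-- Behaviours: a local trace from the empty history, and a Boolean result. -/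
abbrev Behavior := LocalTrace [] × Bool

def SemS (W : WholeS) (t : Behavior) : Prop := FsBeh W [] t.1 t.2

def SemT (W : WholeT) (t : Behavior) : Prop :=
  EBeh W.1 (if t.2 then .tru else .fls) [] t.1

end SEIO


/-!
Both languages are compared through a simulation `Sim R e m`: up to silent steps, the expression `e`
performs the operations of the computation tree `m`, for all their possible results, and ends in
values related by `R`. Silent steps are deterministic and operations have the same possible results
in both languages, so that this one relation yields the inclusion of behaviours in both directions.
It is the expression part of a logical relation indexed by the quotable types, whose compatibility
lemmas serve both translations: a compiled program is related to the source program it comes from,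
and a typed target context to its back-translation. Hence so are the two applications.
-/

namespace SEIO

/-! ### Renamings and substitutions -/

namespace Exp

/-- Extension of a parallel substitution by an expression for the variable `0`, shifting the other
variables; it describes the body of an abstraction once its argument is known. -/
def consSub (v : Exp) (s : ℕ → Exp) : ℕ → Exp
  | 0 => v
  | n + 1 => s n

theorem liftSub_var : liftSub var = var := by
  funext n; cases n <;> rfl

theorem subst_var (e : Exp) : e.subst var = e := by
  induction e <;> simp [*, subst, liftSub_var]

theorem liftRen_comp_liftRen (r' r : ℕ → ℕ) : liftRen r' ∘ liftRen r = liftRen (r' ∘ r) := by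
  funext n; cases n <;> rfl

theorem rename_rename (e : Exp) (r r' : ℕ → ℕ) : (e.rename r).rename r' = e.rename (r' ∘ r) := by
  induction e generalizing r r' <;> simp [*, rename, liftRen_comp_liftRen]

theorem liftSub_comp_liftRen (s : ℕ → Exp) (r : ℕ → ℕ) :
    liftSub s ∘ liftRen r = liftSub (s ∘ r) := by
  funext n; cases n <;> rfl

theorem subst_rename (e : Exp) (s : ℕ → Exp) (r : ℕ → ℕ) :
    (e.rename r).subst s = e.subst (s ∘ r) := by
  induction e generalizing s r <;> simp [*, subst, rename, liftSub_comp_liftRen]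

theorem rename_comp_liftSub (s : ℕ → Exp) (r : ℕ → ℕ) :
    rename (liftRen r) ∘ liftSub s = liftSub (rename r ∘ s) := by
  funext n
  cases n with
  | zero => rfl
  | succ n => simp only [Function.comp, liftSub, rename_rename]; rfl

theorem rename_subst (e : Exp) (s : ℕ → Exp) (r : ℕ → ℕ) :
    (e.subst s).rename r = e.subst (rename r ∘ s) := by
  induction e generalizing s r <;> simp [*, subst, rename, rename_comp_liftSub]

theorem subst_comp_liftSub (s s' : ℕ → Exp) :
    subst (liftSub s') ∘ liftSub s = liftSub (subst s' ∘ s) := by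
  funext n
  cases n with
  | zero => rfl
  | succ n => simp only [Function.comp, liftSub, subst_rename, rename_subst]; rfl

theorem subst_subst (e : Exp) (s s' : ℕ → Exp) :
    (e.subst s).subst s' = e.subst (subst s' ∘ s) := by
  induction e generalizing s s' <;> simp [*, subst, subst_comp_liftSub]

theorem substBeta_subst_liftSub (v e : Exp) (s : ℕ → Exp) :
    substBeta v (e.subst (liftSub s)) = e.subst (consSub v s) := by
  rw [substBeta, subst_subst]
  congr 1
  funext n
  cases n with
  | zero => rfl
  | succ n => exact (subst_rename _ _ _).trans (subst_var _)

theorem closedAt_liftSub {n m : ℕ} {s : ℕ → Exp} (hs : ∀ x < n, (s x).ClosedAt m) :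
    ∀ x < n + 1, (liftSub s x).ClosedAt (m + 1)
  | 0, _ => Nat.succ_pos m
  | x + 1, hx => (hs x (Nat.lt_of_succ_lt_succ hx)).rename _ fun _ => Nat.succ_lt_succ

theorem ClosedAt.subst {e : Exp} {n m : ℕ} {s : ℕ → Exp} (he : e.ClosedAt n)
    (hs : ∀ x < n, (s x).ClosedAt m) : (e.subst s).ClosedAt m := by
  induction e generalizing n m s with
  | var x => exact hs x he
  | unit | tru | fls | fileDescr | string => trivial
  | lam _ ih => exact ih he (closedAt_liftSub hs)
  | fst _ ih | snd _ ih | inl _ ih | inr _ ih | read _ ih | openFile _ ih | close _ ih =>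
    exact ih he hs
  | app _ _ ih1 ih2 | pair _ _ ih1 ih2 | write _ _ ih1 ih2 => exact ⟨ih1 he.1 hs, ih2 he.2 hs⟩
  | ite _ _ _ ih1 ih2 ih3 => exact ⟨ih1 he.1 hs, ih2 he.2.1 hs, ih3 he.2.2 hs⟩
  | case _ _ _ ih1 ih2 ih3 =>
    exact ⟨ih1 he.1 hs, ih2 he.2.1 (closedAt_liftSub hs), ih3 he.2.2 (closedAt_liftSub hs)⟩

end Exp

theorem Typing.closedAt {ε : Eff} {G : TypEnv} {e : Exp} {a : QType} (d : Typing ε G e a) :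
    e.ClosedAt G.length := by
  induction d with
  | var n hn => exact (List.getElem?_eq_some_iff.1 hn).1
  | unit | tru | fls | fileDescr | string => trivial
  | lam _ ih | lamIo _ ih | fst _ ih | snd _ ih | inl _ ih | inr _ ih | read _ ih
  | openFile _ ih | close _ ih => exact ih
  | app _ _ ih1 ih2 | appIo _ _ ih1 ih2 | pair _ _ ih1 ih2 | write _ _ ih1 ih2 => exact ⟨ih1, ih2⟩
  | ite _ _ _ ih1 ih2 ih3 | case _ _ _ ih1 ih2 ih3 => exact ⟨ih1, ih2, ih3⟩

/-! ### Silent steps, operation steps and evaluation frames -/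

theorem Step.not_isValue {e e' : Exp} {h : History} {oev : Option Event} (hs : Step e e' h oev) :
    ¬ e.IsValue := by
  induction hs with
  | pairLeft _ ih => exact fun hv => ih hv.1
  | pairRight _ _ ih => exact fun hv => ih hv.2
  | inl _ ih | inr _ ih => exact ih
  | _ => exact id

/-- From every history, `e` steps silently to `e'`, and it has no other step. -/
structure SilentStep (e e' : Exp) : Prop where
  step (h : History) : Step e e' h none
  inv {e'' : Exp} {h : History} {oev : Option Event} : Step e e'' h oev → oev = none ∧ e'' = e'

/-- From every history, the steps of `e` perform the operation `o` with all its possible results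
`r`, each of them leading to `K r`. -/
structure OpStep (e : Exp) (o : IoOp) (args : IoArgs o) (K : IoRes o → Exp) : Prop where
  step {h : History} {r : IoRes o} :
    IoPost h o args r → Step e (K r) h (some (opToEv o args r))
  inv {e' : Exp} {h : History} {oev : Option Event} : Step e e' h oev →
    ∃ r, IoPost h o args r ∧ oev = some (opToEv o args r) ∧ e' = K r

theorem exists_ioPost (h : History) (o : IoOp) (args : IoArgs o) : ∃ r, IoPost h o args r := by
  cases o with
  | openFile => exact ⟨.inr errMsg, nofun, fun _ he => (Sum.inr.inj he).symm⟩
  | _ => exact ⟨Sum.inr errMsg, fun _ he => (Sum.inr.inj he).symm⟩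

theorem OpStep.exists_step {e : Exp} {o : IoOp} {args : IoArgs o} {K : IoRes o → Exp}
    (hs : OpStep e o args K) (h : History) : ∃ e' oev, Step e e' h oev :=
  let ⟨_, hr⟩ := exists_ioPost h o args
  ⟨_, _, hs.step hr⟩

/-- Evaluation frames: contexts of depth one whose hole is the next subexpression to reduce. -/
inductive IsFrame : (Exp → Exp) → Prop
  | appLeft (e2 : Exp) : IsFrame fun e => .app e e2
  | appRight {v : Exp} : v.IsValue → IsFrame fun e => .app v e
  | ite (e1 e2 : Exp) : IsFrame fun e => .ite e e1 e2
  | pairLeft (e2 : Exp) : IsFrame fun e => .pair e e2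
  | pairRight {v : Exp} : v.IsValue → IsFrame fun e => .pair v e
  | fst : IsFrame .fst
  | snd : IsFrame .snd
  | inl : IsFrame .inl
  | inr : IsFrame .inr
  | case (e1 e2 : Exp) : IsFrame fun e => .case e e1 e2
  | read : IsFrame .read
  | writeLeft (e2 : Exp) : IsFrame fun e => .write e e2
  | writeRight {v : Exp} : v.IsValue → IsFrame fun e => .write v e
  | openFile : IsFrame .openFile
  | close : IsFrame .close

namespace IsFrame

variable {F : Exp → Exp}

theorem step (hF : IsFrame F) {e e' : Exp} {h : History} {oev : Option Event}
    (hs : Step e e' h oev) : Step (F e) (F e') h oev := by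
  cases hF with
  | appRight hv => exact .appRight hv hs
  | pairRight hv => exact .pairRight hv hs
  | writeRight hv => exact .writeRight hv hs
  | _ => constructor; exact hs

/-- Any other step of `F e` would reduce a value, or would contract a redex at `F`, for which `e`
has to be a value or an abstraction. The latter arises since `beta` also contracts abstractions
whose body is not closed, which are not values; they cannot step either. -/
theorem step_inv (hF : IsFrame F) {e e₀ e'' : Exp} {h₀ h : History} {oev₀ oev : Option Event}
    (he : Step e e₀ h₀ oev₀) (hs : Step (F e) e'' h oev) :
    ∃ e', Step e e' h oev ∧ e'' = F e' := by
  have hval : ¬ e.IsValue := he.not_isValue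
  cases hF <;> cases hs <;> first
    | exact ⟨_, ‹Step e _ h oev›, rfl⟩
    | exact absurd ‹Exp.IsValue _› (Step.not_isValue ‹Step _ _ h oev›)
    | exact absurd ‹Exp.IsValue _› hval
    | exact absurd (And.intro ‹Exp.IsValue _› ‹Exp.IsValue _›) hval
    | cases he

theorem silentStep (hF : IsFrame F) {e e' : Exp} (hs : SilentStep e e') :
    SilentStep (F e) (F e') where
  step h := hF.step (hs.step h)
  inv hst := by
    obtain ⟨_, he, rfl⟩ := hF.step_inv (hs.step []) hst
    obtain ⟨rfl, rfl⟩ := hs.inv he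
    exact ⟨rfl, rfl⟩

theorem opStep (hF : IsFrame F) {e : Exp} {o : IoOp} {args : IoArgs o} {K : IoRes o → Exp}
    (hs : OpStep e o args K) : OpStep (F e) o args fun r => F (K r) where
  step hr := hF.step (hs.step hr)
  inv hst := by
    obtain ⟨_, _, he₀⟩ := hs.exists_step []
    obtain ⟨_, he, rfl⟩ := hF.step_inv he₀ hst
    obtain ⟨r, hr, hev, rfl⟩ := hs.inv he
    exact ⟨r, hr, hev, rfl⟩

end IsFrame

/-! ### Redexes -/

/-- The Boolean constants of the target. -/
def Exp.ofBool (b : Bool) : Exp := if b then .tru else .fls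

/-- The target value for the result of an operation, given the target values `f` for the results of
successful calls. -/
def Exp.ofResExn {a : Type} (f : a → Exp) : ResExn a → Exp
  | .inl x => .inl (f x)
  | .inr e => .inr (.string e)

theorem Exp.isValue_ofBool : (b : Bool) → (Exp.ofBool b).IsValue
  | true => trivial
  | false => trivial

theorem Exp.ofBool_injective : Function.Injective Exp.ofBool
  | true, true, _ => rfl
  | false, false, _ => rfl

namespace SilentStep

theorem beta {e v : Exp} (he : e.ClosedAt 1) (hv : v.IsValue) :
    SilentStep (.app (.lam e) v) (substBeta v e) where
  step _ := .beta hv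
  inv
    | .appLeft hs => absurd he hs.not_isValue
    | .appRight _ hs => absurd hv hs.not_isValue
    | .beta _ => ⟨rfl, rfl⟩

theorem iteTrue (e1 e2 : Exp) : SilentStep (.ite .tru e1 e2) e1 where
  step _ := .iteTrue
  inv
    | .iteTrue => ⟨rfl, rfl⟩

theorem iteFalse (e1 e2 : Exp) : SilentStep (.ite .fls e1 e2) e2 where
  step _ := .iteFalse
  inv
    | .iteFalse => ⟨rfl, rfl⟩

theorem ite (b : Bool) (e1 e2 : Exp) : SilentStep (.ite (.ofBool b) e1 e2) (cond b e1 e2) :=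
  match b with
  | true => iteTrue e1 e2
  | false => iteFalse e1 e2

theorem fst {v1 v2 : Exp} (h1 : v1.IsValue) (h2 : v2.IsValue) :
    SilentStep (.fst (.pair v1 v2)) v1 where
  step _ := .fstPair h1 h2
  inv
    | .fst hs => absurd ⟨h1, h2⟩ hs.not_isValue
    | .fstPair _ _ => ⟨rfl, rfl⟩

theorem snd {v1 v2 : Exp} (h1 : v1.IsValue) (h2 : v2.IsValue) :
    SilentStep (.snd (.pair v1 v2)) v2 where
  step _ := .sndPair h1 h2
  inv
    | .snd hs => absurd ⟨h1, h2⟩ hs.not_isValue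
    | .sndPair _ _ => ⟨rfl, rfl⟩

theorem caseInl {v : Exp} (hv : v.IsValue) (e1 e2 : Exp) :
    SilentStep (.case (.inl v) e1 e2) (substBeta v e1) where
  step _ := .caseInl hv
  inv
    | .case hs => absurd hv hs.not_isValue
    | .caseInl _ => ⟨rfl, rfl⟩

theorem caseInr {v : Exp} (hv : v.IsValue) (e1 e2 : Exp) :
    SilentStep (.case (.inr v) e1 e2) (substBeta v e2) where
  step _ := .caseInr hv
  inv
    | .case hs => absurd hv hs.not_isValue
    | .caseInr _ => ⟨rfl, rfl⟩

end SilentStep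

namespace OpStep

theorem read (fd : FileDescr) : OpStep (.read (.fileDescr fd)) .read fd (.ofResExn .string) where
  step {_ r} hr := by
    rcases r with s | err
    · exact .readSuccess fd s _
    · obtain rfl := hr err rfl
      exact .readFail fd _
  inv
    | .readSuccess _ s _ => ⟨.inl s, nofun, rfl, rfl⟩
    | .readFail _ _ => ⟨.inr errMsg, fun _ he => (Sum.inr.inj he).symm, rfl, rfl⟩

theorem write (fd : FileDescr) (s : String) :
    OpStep (.write (.fileDescr fd) (.string s)) .write (fd, s)
      (.ofResExn fun _ : Unit => .unit) where
  step {_ r} hr := by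
    rcases r with _ | err
    · exact .writeSuccess fd s _
    · obtain rfl := hr err rfl
      exact .writeFail fd s _
  inv
    | .writeSuccess _ _ _ => ⟨.inl (), nofun, rfl, rfl⟩
    | .writeFail _ _ _ => ⟨.inr errMsg, fun _ he => (Sum.inr.inj he).symm, rfl, rfl⟩

theorem openFile (s : String) :
    OpStep (.openFile (.string s)) .openFile s (.ofResExn .fileDescr) where
  step {_ r} hr := by
    rcases r with fd | err
    · obtain rfl := hr.1 fd rfl
      exact .openSuccess s _
    · obtain rfl := hr.2 err rfl
      exact .openFail s _
  inv
    | .openSuccess _ h =>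
      ⟨.inl (freshFd h), ⟨fun _ he => (Sum.inl.inj he).symm, nofun⟩, rfl, rfl⟩
    | .openFail _ _ => ⟨.inr errMsg, ⟨nofun, fun _ he => (Sum.inr.inj he).symm⟩, rfl, rfl⟩

theorem close (fd : FileDescr) :
    OpStep (.close (.fileDescr fd)) .close fd (.ofResExn fun _ : Unit => .unit) where
  step {_ r} hr := by
    rcases r with _ | err
    · exact .closeSuccess fd _
    · obtain rfl := hr err rfl
      exact .closeFail fd _
  inv
    | .closeSuccess _ _ => ⟨.inl (), nofun, rfl, rfl⟩
    | .closeFail _ _ => ⟨.inr errMsg, fun _ he => (Sum.inr.inj he).symm, rfl, rfl⟩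

end OpStep

/-! ### Simulation of computations by expressions -/

/-- Up to silent steps, the expression performs the operations of the computation, whatever their
results, and the final values are related by `R`. Being inductive, it also ensures termination. -/
inductive Sim {α : Type} (R : Exp → α → Prop) : Exp → Io α → Prop
  | ret {v : Exp} {x : α} : R v x → Sim R v (.ret x)
  | silent {e e' : Exp} {m : Io α} : SilentStep e e' → Sim R e' m → Sim R e m
  | call {e : Exp} {o : IoOp} {args : IoArgs o} {K : IoRes o → Exp} {k : IoRes o → Io α} :
      OpStep e o args K → (∀ r, Sim R (K r) (k r)) → Sim R e (.call o args k)

theorem Sim.bind {α β : Type} {R : Exp → α → Prop} {S : Exp → β → Prop} {F : Exp → Exp}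
    {k : α → Io β} {e : Exp} {m : Io α} (he : Sim R e m) (hF : IsFrame F)
    (hk : ∀ v x, R v x → Sim S (F v) (k x)) : Sim S (F e) (m.bind k) := by
  induction he with
  | ret hv => exact hk _ _ hv
  | silent hs _ ih => exact .silent (hF.silentStep hs) ih
  | call hs _ ih => exact .call (hF.opStep hs) ih

/-- The target values that behave like the effectful function `f`, for arguments related by `R` and
results related by `S`: abstractions with a closed body that maps related values to simulating
expressions. -/
def FunRel {α β : Type} (R : Exp → α → Prop) (S : Exp → β → Prop) (v : Exp) (f : α → Io β) : Prop :=
  ∃ e : Exp, v = .lam e ∧ e.ClosedAt 1 ∧ ∀ w x, R w x → Sim S (substBeta w e) (f x)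

theorem FunRel.sim_app {α β : Type} {R : Exp → α → Prop} {S : Exp → β → Prop} {v e : Exp}
    {f : α → Io β} {m : Io α} (hR : ∀ w x, R w x → w.IsValue) (hf : FunRel R S v f)
    (he : Sim R e m) : Sim S (.app v e) (m.bind f) := by
  obtain ⟨body, rfl, hbody, hsim⟩ := hf
  exact he.bind (.appRight hbody) fun w x hw =>
    .silent (.beta hbody (hR w x hw)) (hsim w x hw)

/-! ### The logical relation -/

/-- The target values that behave like a source value of a quotable type. -/
def TypeRep.Rel : {a : Type} → TypeRep a → Exp → a → Prop
  | _, .unit, v, _ => v = .unit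
  | _, .bool, v, b => v = .ofBool b
  | _, .fileDescr, v, fd => v = .fileDescr fd
  | _, .string, v, s => v = .string s
  | _, .arr qa qb, v, f => FunRel qa.Rel qb.Rel v fun x => .ret (f x)
  | _, .arrIo qa qb, v, f => FunRel qa.Rel qb.Rel v f
  | _, .pair qa qb, v, p => ∃ v1 v2, v = .pair v1 v2 ∧ qa.Rel v1 p.1 ∧ qb.Rel v2 p.2
  | _, .sum qa qb, v, s =>
      (∃ w x, v = .inl w ∧ s = .inl x ∧ qa.Rel w x) ∨ ∃ w y, v = .inr w ∧ s = .inr y ∧ qb.Rel w y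

theorem TypeRep.Rel.isValue {a : Type} {q : TypeRep a} {v : Exp} {x : a} (hv : q.Rel v x) :
    v.IsValue := by
  induction q generalizing v with
  | unit | fileDescr | string => cases hv; trivial
  | bool => cases hv; exact Exp.isValue_ofBool x
  | arr | arrIo => obtain ⟨_, rfl, hbody, _⟩ := hv; exact hbody
  | pair _ _ iha ihb => obtain ⟨_, _, rfl, h1, h2⟩ := hv; exact ⟨iha h1, ihb h2⟩
  | sum _ _ iha ihb =>
    obtain ⟨w, _, rfl, -, hw⟩ | ⟨w, _, rfl, -, hw⟩ := hv
    exacts [iha (v := w) hw, ihb (v := w) hw]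

theorem rel_ofResExn {a : Type} {q : TypeRep a} {f : a → Exp} (hf : ∀ x, q.Rel (f x) x) :
    (r : ResExn a) → (TypeRep.sum q .string).Rel (.ofResExn f r) r
  | .inl x => .inl ⟨_, x, rfl, rfl, hf x⟩
  | .inr _ => .inr ⟨_, _, rfl, rfl, rfl⟩

/-- The substitutions of values for the variables of `G` that are related to an environment. -/
def EnvRel (G : TypEnv) (s : ℕ → Exp) (g : EvalEnv G) : Prop :=
  ∀ (n : ℕ) {a : QType} (hn : G[n]? = some a), a.2.Rel (s n) (g.lookup n hn)

namespace EnvRel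

variable {G : TypEnv} {a : QType} {s : ℕ → Exp}

theorem nil (s : ℕ → Exp) (g : EvalEnv []) : EnvRel [] s g := nofun

theorem tail {g : EvalEnv (a :: G)} (hg : EnvRel (a :: G) s g) :
    EnvRel G (fun n => s (n + 1)) g.tail :=
  fun n _ hn => hg (n + 1) hn

theorem push {g : EvalEnv G} (hg : EnvRel G s g) {v : Exp} {x : a.1} (hv : a.2.Rel v x) :
    EnvRel (a :: G) (Exp.consSub v s) (g.push x)
  | 0, _, rfl => hv
  | n + 1, _, hn => hg n hn

theorem closedAt_zero {g : EvalEnv G} (hg : EnvRel G s g) (n : ℕ) (hn : n < G.length) :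
    (s n).ClosedAt 0 :=
  (hg n (List.getElem?_eq_getElem hn)).isValue.closed

end EnvRel

/-- The logical relation on open terms: related substitutions and environments turn the expression
`e` into one that simulates the computation. -/
def OpenSim (G : TypEnv) (a : QType) (e : Exp) (m : EvalEnv G → Io a.1) : Prop :=
  ∀ (s : ℕ → Exp) (g : EvalEnv G), EnvRel G s g → Sim a.2.Rel (e.subst s) (m g)

/-! ### Compatibility of the logical relation with the target constructs -/

namespace OpenSim

variable {G : TypEnv} {a b c : QType} {e e1 e2 e3 : Exp}

theorem sim {m : EvalEnv [] → Io a.1} (h : OpenSim [] a e m) : Sim a.2.Rel e (m ()) := by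
  simpa only [Exp.subst_var] using h .var () (.nil _ _)

theorem var (n : ℕ) (hn : G[n]? = some a) : OpenSim G a (.var n) fun g => .ret (g.lookup n hn) :=
  fun _ _ hg => .ret (hg n hn)

theorem weaken {m : EvalEnv G → Io a.1} (h : OpenSim G a e m) :
    OpenSim (b :: G) a (e.rename Nat.succ) fun g => m g.tail := by
  intro s g hg
  rw [Exp.subst_rename]
  exact h _ _ hg.tail

theorem sim_substBeta {m : EvalEnv (a :: G) → Io b.1} (h : OpenSim (a :: G) b e m) {s : ℕ → Exp}
    {g : EvalEnv G} (hg : EnvRel G s g) {v : Exp} {x : a.1} (hv : a.2.Rel v x) :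
    Sim b.2.Rel (substBeta v (e.subst (liftSub s))) (m (g.push x)) := by
  rw [Exp.substBeta_subst_liftSub]
  exact h _ _ (hg.push hv)

theorem funRel {m : EvalEnv (a :: G) → Io b.1} (h : OpenSim (a :: G) b e m)
    (he : e.ClosedAt (a :: G).length) {s : ℕ → Exp} {g : EvalEnv G} (hg : EnvRel G s g) :
    FunRel a.2.Rel b.2.Rel ((Exp.lam e).subst s) fun x => m (g.push x) :=
  ⟨_, rfl, he.subst (Exp.closedAt_liftSub hg.closedAt_zero), fun _ _ => h.sim_substBeta hg⟩

theorem lam {f : EvalEnv (a :: G) → b.1} (he : e.ClosedAt (a :: G).length)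
    (h : OpenSim (a :: G) b e fun g => .ret (f g)) :
    OpenSim G (qArr a b) (.lam e) fun g => .ret fun x => f (g.push x) :=
  fun _ _ hg => .ret (h.funRel he hg)

theorem lamIo {m : EvalEnv (a :: G) → Io b.1} (he : e.ClosedAt (a :: G).length)
    (h : OpenSim (a :: G) b e m) :
    OpenSim G (qArrIo a b) (.lam e) fun g => .ret fun x => m (g.push x) :=
  fun _ _ hg => .ret (h.funRel he hg)

theorem letIn {m1 : EvalEnv G → Io a.1} {m2 : EvalEnv (a :: G) → Io b.1}
    (he : e2.ClosedAt (a :: G).length) (h1 : OpenSim G a e1 m1) (h2 : OpenSim (a :: G) b e2 m2) :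
    OpenSim G b (.app (.lam e2) e1) fun g => (m1 g).bind fun x => m2 (g.push x) :=
  fun s g hg => (h2.funRel he hg).sim_app (fun _ _ => TypeRep.Rel.isValue) (h1 s g hg)

theorem app {m1 : EvalEnv G → Io (a.1 → b.1)} {m2 : EvalEnv G → Io a.1}
    (h1 : OpenSim G (qArr a b) e1 m1) (h2 : OpenSim G a e2 m2) :
    OpenSim G b (.app e1 e2) fun g => (m1 g).bind fun f => (m2 g).bind fun x => .ret (f x) :=
  fun s g hg => (h1 s g hg).bind (.appLeft _) fun _ _ hf =>
    FunRel.sim_app (fun _ _ => TypeRep.Rel.isValue) hf (h2 s g hg)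

theorem appIo {m1 : EvalEnv G → Io (a.1 → Io b.1)} {m2 : EvalEnv G → Io a.1}
    (h1 : OpenSim G (qArrIo a b) e1 m1) (h2 : OpenSim G a e2 m2) :
    OpenSim G b (.app e1 e2) fun g => (m1 g).bind fun f => (m2 g).bind fun x => f x :=
  fun s g hg => (h1 s g hg).bind (.appLeft _) fun _ _ hf =>
    FunRel.sim_app (fun _ _ => TypeRep.Rel.isValue) hf (h2 s g hg)

theorem ite {m1 : EvalEnv G → Io Bool} {m2 m3 : EvalEnv G → Io a.1} (h1 : OpenSim G qBool e1 m1)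
    (h2 : OpenSim G a e2 m2) (h3 : OpenSim G a e3 m3) :
    OpenSim G a (.ite e1 e2 e3) fun g => (m1 g).bind fun c => cond c (m2 g) (m3 g) := by
  intro s g hg
  refine (h1 s g hg).bind (.ite _ _) ?_
  rintro _ b rfl
  refine .silent (.ite b _ _) ?_
  cases b
  exacts [h3 s g hg, h2 s g hg]

theorem pair {m1 : EvalEnv G → Io a.1} {m2 : EvalEnv G → Io b.1} (h1 : OpenSim G a e1 m1)
    (h2 : OpenSim G b e2 m2) :
    OpenSim G (qPair a b) (.pair e1 e2) fun g =>
      (m1 g).bind fun x => (m2 g).bind fun y => .ret (x, y) :=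
  fun s g hg => (h1 s g hg).bind (.pairLeft _) fun v _ hv =>
    (h2 s g hg).bind (.pairRight hv.isValue) fun w _ hw => .ret ⟨v, w, rfl, hv, hw⟩

theorem fst {m : EvalEnv G → Io (a.1 × b.1)} (h : OpenSim G (qPair a b) e m) :
    OpenSim G a (.fst e) fun g => (m g).bind fun p => .ret p.1 := by
  intro s g hg
  refine (h s g hg).bind .fst ?_
  rintro _ _ ⟨v, w, rfl, hv, hw⟩
  exact .silent (.fst hv.isValue hw.isValue) (.ret hv)

theorem snd {m : EvalEnv G → Io (a.1 × b.1)} (h : OpenSim G (qPair a b) e m) :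
    OpenSim G b (.snd e) fun g => (m g).bind fun p => .ret p.2 := by
  intro s g hg
  refine (h s g hg).bind .snd ?_
  rintro _ _ ⟨v, w, rfl, hv, hw⟩
  exact .silent (.snd hv.isValue hw.isValue) (.ret hw)

theorem inl {m : EvalEnv G → Io a.1} (h : OpenSim G a e m) :
    OpenSim G (qSum a b) (.inl e) fun g => (m g).bind fun x => .ret (Sum.inl x) :=
  fun s g hg => (h s g hg).bind .inl fun v x hv => .ret (.inl ⟨v, x, rfl, rfl, hv⟩)

theorem inr {m : EvalEnv G → Io b.1} (h : OpenSim G b e m) :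
    OpenSim G (qSum a b) (.inr e) fun g => (m g).bind fun y => .ret (Sum.inr y) :=
  fun s g hg => (h s g hg).bind .inr fun v y hv => .ret (.inr ⟨v, y, rfl, rfl, hv⟩)

theorem case {m1 : EvalEnv G → Io (a.1 ⊕ b.1)} {m2 : EvalEnv (a :: G) → Io c.1}
    {m3 : EvalEnv (b :: G) → Io c.1} (h1 : OpenSim G (qSum a b) e1 m1)
    (h2 : OpenSim (a :: G) c e2 m2) (h3 : OpenSim (b :: G) c e3 m3) :
    OpenSim G c (.case e1 e2 e3) fun g => (m1 g).bind fun s =>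
      Sum.elim (fun x => m2 (g.push x)) (fun y => m3 (g.push y)) s := by
  intro s g hg
  refine (h1 s g hg).bind (.case _ _) ?_
  rintro _ _ (⟨w, x, rfl, rfl, hw⟩ | ⟨w, y, rfl, rfl, hw⟩)
  · exact .silent (.caseInl hw.isValue _ _) (h2.sim_substBeta hg hw)
  · exact .silent (.caseInr hw.isValue _ _) (h3.sim_substBeta hg hw)

theorem read {m : EvalEnv G → Io FileDescr} (h : OpenSim G qFileDescr e m) :
    OpenSim G (qResExn qString) (.read e) fun g => (m g).bind fun fd => ioRead fd := by
  intro s g hg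
  refine (h s g hg).bind .read ?_
  rintro _ fd rfl
  exact .call (.read fd) fun r => .ret (rel_ofResExn (q := .string) (fun _ => rfl) r)

theorem write {m1 : EvalEnv G → Io FileDescr} {m2 : EvalEnv G → Io String}
    (h1 : OpenSim G qFileDescr e1 m1) (h2 : OpenSim G qString e2 m2) :
    OpenSim G (qResExn qUnit) (.write e1 e2) fun g =>
      (m1 g).bind fun fd => (m2 g).bind fun s => ioWrite fd s := by
  intro s g hg
  refine (h1 s g hg).bind (.writeLeft _) ?_
  rintro _ fd rfl
  refine (h2 s g hg).bind (.writeRight (v := .fileDescr fd) trivial) ?_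
  rintro _ str rfl
  exact .call (.write fd str) fun r => .ret (rel_ofResExn (q := .unit) (fun _ => rfl) r)

theorem openFile {m : EvalEnv G → Io String} (h : OpenSim G qString e m) :
    OpenSim G (qResExn qFileDescr) (.openFile e) fun g => (m g).bind fun s => ioOpen s := by
  intro s g hg
  refine (h s g hg).bind .openFile ?_
  rintro _ str rfl
  exact .call (.openFile str) fun r => .ret (rel_ofResExn (q := .fileDescr) (fun _ => rfl) r)

theorem close {m : EvalEnv G → Io FileDescr} (h : OpenSim G qFileDescr e m) :
    OpenSim G (qResExn qUnit) (.close e) fun g => (m g).bind fun fd => ioClose fd := by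
  intro s g hg
  refine (h s g hg).bind .close ?_
  rintro _ fd rfl
  exact .call (.close fd) fun r => .ret (rel_ofResExn (q := .unit) (fun _ => rfl) r)

end OpenSim

/-! ### Compilation and back-translation preserve meaning -/

theorem apply_sumElim {α β γ δ : Type} (f : γ → δ) (l : α → γ) (r : β → γ) (s : α ⊕ β) :
    f (Sum.elim l r s) = Sum.elim (fun x => f (l x)) (fun y => f (r y)) s :=
  congrFun (Sum.comp_elim f l r) s

mutual

theorem openSim_compileVal : {G : TypEnv} → {a : QType} → {x : EvalEnv G → a.1} →
    (d : TypingOVal G a x) → OpenSim G a (compileVal d) fun g => .ret (x g)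
  | _, _, _, .qtt => fun _ _ _ => .ret rfl
  | _, _, _, .qtrue => fun _ _ _ => .ret rfl
  | _, _, _, .qfalse => fun _ _ _ => .ret rfl
  | _, _, _, .qstringLit _ => fun _ _ _ => .ret rfl
  | _, _, _, .qvar0 => .var 0 rfl
  | _, _, _, .qvarS d => (openSim_compileVal d).weaken
  | _, _, _, .qapp d1 d2 => (openSim_compileVal d1).app (openSim_compileVal d2)
  | _, _, _, .qlambda d => .lam (compileVal_closed d) (openSim_compileVal d)
  | _, _, _, .qlambdaIo d => .lamIo (compileProd_closed d) (openSim_compileProd d)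
  | _, _, _, .qif d1 d2 d3 => by
    simpa only [compileVal, Io.bind, Bool.apply_cond Io.ret] using
      (openSim_compileVal d1).ite (openSim_compileVal d2) (openSim_compileVal d3)
  | _, _, _, .qmkpair d1 d2 => (openSim_compileVal d1).pair (openSim_compileVal d2)
  | _, _, _, .qfst d => (openSim_compileVal d).fst
  | _, _, _, .qsnd d => (openSim_compileVal d).snd
  | _, _, _, .qinl d => (openSim_compileVal d).inl
  | _, _, _, .qinr d => (openSim_compileVal d).inr
  | _, _, _, .qcase d1 d2 d3 => by
    simpa only [compileVal, Io.bind, apply_sumElim Io.ret] using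
      (openSim_compileVal d1).case (openSim_compileVal d2) (openSim_compileVal d3)

theorem openSim_compileProd : {G : TypEnv} → {a : QType} → {m : EvalEnv G → Io a.1} →
    (d : TypingOProd G a m) → OpenSim G a (compileProd d) m
  | _, _, _, .qreturn d => openSim_compileVal d
  | _, _, _, .qbind d1 d2 =>
    .letIn (compileProd_closed d2) (openSim_compileProd d1) (openSim_compileProd d2)
  | _, _, _, .qappIo d1 d2 => (openSim_compileVal d1).appIo (openSim_compileVal d2)
  | _, _, _, .qifIo d1 d2 d3 =>
    (openSim_compileVal d1).ite (openSim_compileProd d2) (openSim_compileProd d3)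
  | _, _, _, .qcaseIo d1 d2 d3 =>
    (openSim_compileVal d1).case (openSim_compileProd d2) (openSim_compileProd d3)
  | _, _, _, .qread d => (openSim_compileVal d).read
  | _, _, _, .qwrite d1 d2 => (openSim_compileVal d1).write (openSim_compileVal d2)
  | _, _, _, .qopenfile d => (openSim_compileVal d).openFile
  | _, _, _, .qclose d => (openSim_compileVal d).close

end

/-- The computation that a source denotation of effect `ε` stands for, so that pure and effectful
expressions have a common notion of simulation. -/
def Eff.toIo : (ε : Eff) → {a : Type} → ε.M a → Io a
  | .pure, _, x => .ret x
  | .io, _, m => m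

theorem Eff.toIo_ret (ε : Eff) {a : Type} (x : a) : ε.toIo (ε.ret x) = .ret x := by
  cases ε <;> rfl

theorem Eff.toIo_bind (ε : Eff) {a b : Type} (m : ε.M a) (k : a → ε.M b) :
    ε.toIo (ε.bind m k) = (ε.toIo m).bind fun x => ε.toIo (k x) := by
  cases ε <;> rfl

theorem OpenSim.toIo_ret {G : TypEnv} {a : QType} {e : Exp} {x : EvalEnv G → a.1}
    (h : OpenSim G a e fun g => .ret (x g)) (ε : Eff) :
    OpenSim G a e fun g => ε.toIo (ε.ret (x g)) := by
  simpa only [Eff.toIo_ret] using h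

theorem openSim_backExp {ε : Eff} {G : TypEnv} {e : Exp} {a : QType} (d : Typing ε G e a) :
    OpenSim G a e fun g => ε.toIo (backExp d g) := by
  induction d with
  | var n hn => exact OpenSim.toIo_ret (.var n hn) _
  | unit | tru | fls | fileDescr | string =>
    refine OpenSim.toIo_ret ?_ _
    exact fun _ _ _ => .ret rfl
  | lam d ih => exact OpenSim.toIo_ret (.lam d.closedAt ih) _
  | lamIo d ih => exact OpenSim.toIo_ret (.lamIo d.closedAt ih) _
  | app _ _ ih1 ih2 => simpa only [backExp, Eff.toIo_ret, Eff.toIo_bind] using ih1.app ih2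
  | appIo _ _ ih1 ih2 => exact ih1.appIo ih2
  | ite _ _ _ ih1 ih2 ih3 =>
    simpa only [backExp, Eff.toIo_bind, Bool.apply_cond (Eff.toIo _)] using ih1.ite ih2 ih3
  | pair _ _ ih1 ih2 => simpa only [backExp, Eff.toIo_ret, Eff.toIo_bind] using ih1.pair ih2
  | fst _ ih => simpa only [backExp, Eff.toIo_ret, Eff.toIo_bind] using ih.fst
  | snd _ ih => simpa only [backExp, Eff.toIo_ret, Eff.toIo_bind] using ih.snd
  | inl _ ih => simpa only [backExp, Eff.toIo_ret, Eff.toIo_bind] using ih.inl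
  | inr _ ih => simpa only [backExp, Eff.toIo_ret, Eff.toIo_bind] using ih.inr
  | case _ _ _ ih1 ih2 ih3 =>
    simpa only [backExp, Eff.toIo_bind, apply_sumElim (Eff.toIo _)] using ih1.case ih2 ih3
  | read _ ih => exact ih.read
  | write _ _ ih1 ih2 => exact ih1.write ih2
  | openFile _ ih => exact ih.openFile
  | close _ ih => exact ih.close

theorem sim_linkT {I : Interface} (P : ProgS I) (C : CtxT I) :
    Sim TypeRep.bool.Rel (linkT (compile P) C).1 (linkS P (backTranslate C)) :=
  ((openSim_compileVal P.2).appIo (openSim_backExp C.2)).sim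

/-! ### Adequacy of simulation for behaviours -/

/-- The traces and results of a computation from a history, by recursion on the computation. -/
def Io.HasTrace {a : Type} : Io a → History → Trace → a → Prop
  | .ret x, _, lt, r => lt = [] ∧ r = x
  | .call o args k, h, lt, r => ∃ res lt', IoPost h o args res ∧
      lt = opToEv o args res :: lt' ∧ (k res).HasTrace (opToEv o args res :: h) lt' r

theorem theta_hasTrace {a : Type} (m : Io a) (h : History) :
    (theta m).1 h fun lt r => m.HasTrace h lt.1 r := by
  induction m generalizing h with
  | ret x => exact ⟨rfl, rfl⟩
  | call o args k ih =>
    rintro ⟨_, hlt⟩ res ⟨hres, rfl⟩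
    exact (theta (k res)).2 _ _ _ (fun lt' _ hm => ⟨res, lt'.1, hres, rfl, hm⟩) (ih res _)

theorem Io.HasTrace.of_theta {a : Type} {m : Io a} {h : History} {p : HistPost h a}
    (hp : (theta m).1 h p) (lt : LocalTrace h) {r : a} (hm : m.HasTrace h lt.1 r) : p lt r := by
  induction m generalizing h with
  | ret x =>
    obtain ⟨lt, hlt⟩ := lt
    obtain ⟨rfl, rfl⟩ := hm
    exact hp
  | call o args k ih =>
    obtain ⟨lt, hlt⟩ := lt
    obtain ⟨res, lt', hres, rfl, hm⟩ := hm
    exact ih res (hp ⟨[opToEv o args res], hlt.1, trivial⟩ res ⟨hres, rfl⟩) ⟨lt', hlt.2⟩ hm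

theorem fsBeh_iff_hasTrace {a : Type} (m : Io a) (h : History) (lt : LocalTrace h) (r : a) :
    FsBeh m h lt r ↔ m.HasTrace h lt.1 r :=
  ⟨fun hb => hb _ (theta_hasTrace m h), fun hm _ hp => hm.of_theta hp lt⟩

namespace Sim

variable {α : Type} {R : Exp → α → Prop} {e : Exp} {m : Io α} {h : History} {lt : Trace}

theorem exists_hasTrace_of_steps (he : Sim R e m) (hR : ∀ v x, R v x → v.IsValue) {v : Exp}
    (hv : v.IsValue) (hs : Steps e v h lt) : ∃ x, R v x ∧ m.HasTrace h lt x := by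
  induction he generalizing h lt with
  | @ret w x hw =>
    cases hs with
    | refl => exact ⟨x, hw, rfl, rfl⟩
    | trans hst _ => exact absurd (hR w x hw) hst.not_isValue
  | silent hsil _ ih =>
    cases hs with
    | refl => exact absurd hv (hsil.step []).not_isValue
    | trans hst hs =>
      obtain ⟨rfl, rfl⟩ := hsil.inv hst
      exact ih hs
  | call hop _ ih =>
    cases hs with
    | refl =>
      obtain ⟨_, _, hst⟩ := hop.exists_step []
      exact absurd hv hst.not_isValue
    | trans hst hs =>
      obtain ⟨res, hres, rfl, rfl⟩ := hop.inv hst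
      obtain ⟨x, hx, hm⟩ := ih res hs
      exact ⟨x, hx, res, _, hres, rfl, hm⟩

theorem exists_steps_of_hasTrace (he : Sim R e m) {x : α} (hm : m.HasTrace h lt x) :
    ∃ v, R v x ∧ Steps e v h lt := by
  induction he generalizing h lt with
  | @ret w y hw =>
    obtain ⟨rfl, rfl⟩ := hm
    exact ⟨w, hw, .refl w h⟩
  | silent hsil _ ih =>
    obtain ⟨v, hv, hs⟩ := ih hm
    exact ⟨v, hv, .trans (hsil.step h) hs⟩
  | call hop _ ih =>
    obtain ⟨res, lt', hres, rfl, hm⟩ := hm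
    obtain ⟨v, hv, hs⟩ := ih res hm
    exact ⟨v, hv, .trans (hop.step hres) hs⟩

theorem steps_ofBool_iff {e : Exp} {m : Io Bool} (he : Sim TypeRep.bool.Rel e m) (b : Bool) :
    Steps e (.ofBool b) h lt ↔ m.HasTrace h lt b := by
  constructor
  · intro hs
    obtain ⟨c, hc, hm⟩ :=
      he.exists_hasTrace_of_steps (fun _ _ => TypeRep.Rel.isValue) (Exp.isValue_ofBool b) hs
    rwa [Exp.ofBool_injective hc]
  · intro hm
    obtain ⟨_, rfl, hs⟩ := he.exists_steps_of_hasTrace hm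
    exact hs

end Sim

theorem Exp.IsValue.irreducible {v : Exp} (hv : v.IsValue) (h : History) : Irreducible v h :=
  fun _ _ hs => hs.not_isValue hv

theorem Sim.eBeh_ofBool_iff_fsBeh {e : Exp} {m : Io Bool} (he : Sim TypeRep.bool.Rel e m)
    (b : Bool) (h : History) (lt : LocalTrace h) : EBeh e (.ofBool b) h lt ↔ FsBeh m h lt b := by
  rw [EBeh, and_iff_left ((Exp.isValue_ofBool b).irreducible _), he.steps_ofBool_iff,
    fsBeh_iff_hasTrace]

end SEIO

/-- Robust relational hyperproperty preservation: every typed target context has a source context,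
namely its back-translation, that behaves in the same way with all source programs. -/
theorem mainTheorem1 (I : SEIO.Interface) (CT : SEIO.CtxT I) :
    ∃ CS : SEIO.CtxS I, CS = SEIO.backTranslate CT ∧
      ∀ (P : SEIO.ProgS I) (t : SEIO.Behavior),
        SEIO.SemT (SEIO.linkT (SEIO.compile P) CT) t ↔ SEIO.SemS (SEIO.linkS P CS) t :=
  ⟨SEIO.backTranslate CT, rfl, fun P t => (SEIO.sim_linkT P CT).eBeh_ofBool_iff_fsBeh t.2 [] t.1⟩
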